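/- Let $X\subseteq\mathbb R^n$ be a compact connected set and let $f:\mathbb N\to\mathbb N$ be a strictly increasing local connectivity function for $X$: for all $k\in\mathbb N$ and $p\in X$, every point of $X$ at distance less than $2^{-f(k)}$ from $p$ lies in the connected component of $p$ in $X\cap B_{2^{-k}}(p)$. Here distances and diameters are Euclidean, and $B_\delta(S)$ is the union of the open balls of radius $\delta$ centred at the points of $S$. A rational box is a set $(a_1,b_1)\times\dots\times(a_n,b_n)$ with $a_i<b_i$ rational. A witnessing chain is a sequence $\omega=(m,R_1,\dots,R_k)$, $m\in\mathbb N$, $k\ge1$, of rational boxes $R_i$ with $\operatorname{diam}(R_i)<2^{-f(m)}$ for all $i$ and $R_i\cap R_{i+1}\cap X\ne\emptyset$ for $1\le i<k$. Put $V_\omega=\bigcup_i B_{2^{-m}}(R_i)$ and $C_\omega=\bigcup_i C_{\omega,i}$, where $C_{\omega,i}$ is the connected component in $X\cap B_{2^{-m}}(R_i)$ of any point of $R_i\cap X$ (all these points have the same component; $C_{\omega,i}=\emptyset$ if $R_i\cap X=\emptyset$). A sequence of sets $(U_1,\dots,U_k)$ is a simple chain if $U_i\cap U_j\neq\emptyset$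 exactly when $|i-j|\le1$; it is a simple chain from $x$ to $y$ if moreover $k\ge 1$, $x\in U_1\setminus\bigcup_{1<j\le k}U_j$ and $y\in U_k\setminus\bigcup_{1\le j<k}U_j$. An arc chain is a sequence $\mathfrak p=(\omega_1,\dots,\omega_l)$, $l\ge1$, of witnessing chains such that $(V_{\omega_1},\dots,V_{\omega_l})$ is a simple chain and, for $1\le i<l$, $X$, the last box of $\omega_i$ and the first box of $\omega_{i+1}$ have a common point. Its diameter is $\max_i\operatorname{diam}(V_{\omega_i})$. It is an arc chain from $x$ to $y$ if $(V_{\omega_1},\dots,V_{\omega_l})$ is a simple chain from $x$ to $y$. An arc chain $(\omega'_1,\dots,\omega'_k)$ narrowly goes straight through $(\omega_1,\dots,\omega_l)$ if there are integers $0=t_0<t_1<\dots<t_l=k$ such that $\overline{V_{\omega'_j}}\subseteq V_{\omega_i}$ whenever $t_{i-1}+1\le j\le t_i$. Theorem. Let $\mathfrak p=(\omega_1,\dots,\omega_l)$ be an arc chain from $x$ to $y$ with $x\in C_{\omega_1}$ and $y\in C_{\omega_l}$. Then for every $\varepsilon>0$ there is an arc chain $\mathfrak q=(\omega'_1,\dots,\omega'_k)$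 from $x$ to $y$, again with $x\in C_{\omega'_1}$ and $y\in C_{\omega'_k}$, whose diameter is less than $\varepsilon$ and which narrowly goes straight through $\mathfrak p$. -/

import Mathlib

open Set Metric

/-- A sequence of sets `U` is a simple chain if `U i` meets `U j` precisely when `|i - j| ≤ 1`. -/
def IsSimpleChain {α : Type*} {k : ℕ} (U : Fin k → Set α) : Prop :=
  ∀ i j : Fin k, (U i ∩ U j).Nonempty ↔ |((i : ℕ) : ℤ) - ((j : ℕ) : ℤ)| ≤ 1

/-- A simple chain from `x` to `y`: the point `x` lies in the first set and in no other one,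
the point `y` lies in the last set and in no other one. -/
def IsSimpleChainFrom {α : Type*} {k : ℕ} (U : Fin k → Set α) (x y : α) : Prop :=
  IsSimpleChain U ∧ ∃ hk : 0 < k,
    (x ∈ U ⟨0, hk⟩ \ ⋃ j : Fin k, ⋃ _ : 0 < (j : ℕ), U j) ∧
    (y ∈ U ⟨k - 1, Nat.sub_lt hk one_pos⟩ \ ⋃ j : Fin k, ⋃ _ : (j : ℕ) < k - 1, U j)

/-- The diameter of a chain of bounded sets: the maximum of the diameters of its members. -/
noncomputable def chainDiam {α : Type*} [PseudoMetricSpace α] {k : ℕ} (U : Fin k → Set α) : ℝ :=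
  ⨆ i, Metric.diam (U i)

/-- The chain `U` (of length `k`) narrowly goes straight through the chain `V` (of length `l`):
there are `0 = t 0 < t 1 < ⋯ < t l = k` such that the closures of the members of `U` number
`t (i - 1) + 1, …, t i` lie in the member of `V` number `i`.  As `Fin` counts from `0`, these are
the members `U j` with `t i ≤ j < t (i + 1)`, and their closures lie in `V i`. -/
def NarrowlyGoesStraightThrough {α : Type*} [TopologicalSpace α] {k l : ℕ}
    (U : Fin k → Set α) (V : Fin l → Set α) : Prop :=
  ∃ t : Fin (l + 1) → ℕ, t 0 = 0 ∧ StrictMono t ∧ t (Fin.last l) = k ∧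
    ∀ (i : Fin l) (j : Fin k), t i.castSucc ≤ (j : ℕ) → (j : ℕ) < t i.succ →
      closure (U j) ⊆ V i

/-- A rational box: a product of nonempty open intervals with rational endpoints. -/
def IsRationalBox {n : ℕ} (S : Set (EuclideanSpace ℝ (Fin n))) : Prop :=
  ∃ a b : Fin n → ℚ, (∀ i, a i < b i) ∧ S = {x | ∀ i, (a i : ℝ) < x i ∧ x i < (b i : ℝ)}

/-- A local connectivity function for `X`: every point of `X` at distance less than `2 ^ (-f k)`
from `p ∈ X` lies in the connected component of `p` in `X ∩ B(p, 2 ^ (-k))`. -/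
def IsLCFunction {n : ℕ} (X : Set (EuclideanSpace ℝ (Fin n))) (f : ℕ → ℕ) : Prop :=
  ∀ k : ℕ, ∀ p ∈ X,
    X ∩ ball p ((2 : ℝ) ^ (-(f k : ℤ))) ⊆
      connectedComponentIn (ball p ((2 : ℝ) ^ (-(k : ℤ))) ∩ X) p

/-- A witnessing chain `(m, R_1, …, R_k)`, with `k ≥ 1`. -/
structure WitnessingChain {n : ℕ} (X : Set (EuclideanSpace ℝ (Fin n))) (f : ℕ → ℕ) where
  m : ℕ
  k : ℕ
  k_pos : 0 < k
  R : Fin k → Set (EuclideanSpace ℝ (Fin n))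
  isRationalBox : ∀ i, IsRationalBox (R i)
  meets : ∀ i j : Fin k, (i : ℕ) + 1 = (j : ℕ) → (R i ∩ R j ∩ X).Nonempty
  diam_lt : ∀ i, Metric.diam (R i) < (2 : ℝ) ^ (-(f m : ℤ))

namespace WitnessingChain

variable {n : ℕ} {X : Set (EuclideanSpace ℝ (Fin n))} {f : ℕ → ℕ}

/-- The first box `R_1`. -/
def firstBox (w : WitnessingChain X f) : Set (EuclideanSpace ℝ (Fin n)) :=
  w.R ⟨0, w.k_pos⟩

/-- The last box `R_k`. -/
def lastBox (w : WitnessingChain X f) : Set (EuclideanSpace ℝ (Fin n)) :=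
  w.R ⟨w.k - 1, Nat.sub_lt w.k_pos one_pos⟩

/-- The open `2 ^ (-m)`-neighbourhood of the box number `i`. -/
def nbhd (w : WitnessingChain X f) (i : Fin w.k) : Set (EuclideanSpace ℝ (Fin n)) :=
  thickening ((2 : ℝ) ^ (-(w.m : ℤ))) (w.R i)

/-- The set `V_ω`: the union of the open `2 ^ (-m)`-neighbourhoods of the boxes. -/
def V (w : WitnessingChain X f) : Set (EuclideanSpace ℝ (Fin n)) :=
  ⋃ i, w.nbhd i

/-- The set `C_{ω,i}`: the connected component in `X ∩ B(R_i, 2 ^ (-m))` of any point `z` of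
`R_i ∩ X`.  When `f` is a local connectivity function for `X`, all these points have the same
component, so that the union over `z` is just this component. -/
def Cset (w : WitnessingChain X f) (i : Fin w.k) : Set (EuclideanSpace ℝ (Fin n)) :=
  ⋃ z ∈ w.R i ∩ X, connectedComponentIn (w.nbhd i ∩ X) z

/-- The set `C_ω`, the union of the sets `C_{ω,i}`. -/
def C (w : WitnessingChain X f) : Set (EuclideanSpace ℝ (Fin n)) :=
  ⋃ i, w.Cset i

end WitnessingChain

/-- An arc chain `(ω_1, …, ω_l)`, with `l ≥ 1`. -/
structure ArcChain {n : ℕ} (X : Set (EuclideanSpace ℝ (Fin n))) (f : ℕ → ℕ) where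
  l : ℕ
  l_pos : 0 < l
  w : Fin l → WitnessingChain X f
  isSimpleChain : IsSimpleChain fun i => (w i).V
  meets : ∀ i j : Fin l, (i : ℕ) + 1 = (j : ℕ) →
    (X ∩ (w i).lastBox ∩ (w j).firstBox).Nonempty

namespace ArcChain

variable {n : ℕ} {X : Set (EuclideanSpace ℝ (Fin n))} {f : ℕ → ℕ}

/-- The sequence of sets `V_{𝔭,1}, …, V_{𝔭,l}`. -/
def V (p : ArcChain X f) (i : Fin p.l) : Set (EuclideanSpace ℝ (Fin n)) :=
  (p.w i).V

/-- The sequence of sets `C_{𝔭,1}, …, C_{𝔭,l}`. -/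
def C (p : ArcChain X f) (i : Fin p.l) : Set (EuclideanSpace ℝ (Fin n)) :=
  (p.w i).C

/-- The index of the first member. -/
def first (p : ArcChain X f) : Fin p.l := ⟨0, p.l_pos⟩

/-- The index of the last member. -/
def last (p : ArcChain X f) : Fin p.l := ⟨p.l - 1, Nat.sub_lt p.l_pos one_pos⟩

/-- `p` is an arc chain from `x` to `y`. -/
def IsFrom (p : ArcChain X f) (x y : EuclideanSpace ℝ (Fin n)) : Prop :=
  IsSimpleChainFrom p.V x y

/-- The diameter of an arc chain. -/
noncomputable def diam (p : ArcChain X f) : ℝ := chainDiam p.V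

/-- The arc chain `q` narrowly goes straight through the arc chain `p`. -/
def GoesThrough (q p : ArcChain X f) : Prop :=
  NarrowlyGoesStraightThrough q.V p.V

end ArcChain

/-! By local connectivity, each point of `C_{𝔭,i}` has arbitrarily small compact connected
neighbourhoods in `X` inside `C_{𝔭,i}` (`exists_compact_nhd`); call these pieces and label them `i`.
Each `C_{𝔭,i}` is connected and meets the next one, so `x` and `y` are joined by a path of
successively meeting pieces whose labels never decrease (`exists_path`).

Take a shortest such path. Two non-neighbouring pieces that met would give a shortcut, so they are
disjoint, and `x` and `y` lie in the end pieces only (`exists_simple_path`). Since the `V_{𝔭,i}`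
form a simple chain, labels rise by at most one per step, so the path splits into `l` consecutive
blocks (`exists_blocks_of_labels`).

The finitely many pieces are compact, so for small `δ` their `δ`-neighbourhoods keep these
disjointness relations and stay inside the sets `V_{𝔭,i}`. In the `δ`-neighbourhood of each piece, a
witnessing chain of tiny boxes runs from a point shared with the previous piece to a point shared
with the next (`exists_of_isPreconnected`), with `x` and `y` at the two extremes. These chains form
the required arc chain. -/

/-! ### Chains in a relation -/

/-- A path in a relation, as a finite sequence. -/
theorem exists_seq_of_reflTransGen {A : Type*} {r : A → A → Prop} {a b : A}
    (h : Relation.ReflTransGen r a b) :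
    ∃ (N : ℕ) (v : ℕ → A), v 0 = a ∧ v N = b ∧ ∀ j < N, r (v j) (v (j + 1)) := by
  induction h using Relation.ReflTransGen.head_induction_on with
  | refl => exact ⟨0, fun _ => b, rfl, rfl, by simp⟩
  | @head a c hac _ ih =>
    obtain ⟨N, v, h0, hN, hv⟩ := ih
    refine ⟨N + 1, fun j => Nat.casesOn j a v, rfl, hN, ?_⟩
    rintro (_ | j) hj
    · simpa [h0] using hac
    · exact hv j (by omega)

/-- Among the paths from a set of starting vertices to a set of final vertices, a shortest one has
no shortcuts, and no inner vertex of it is a starting or final vertex. -/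
theorem exists_minimal_seq {A : Type*} {r : A → A → Prop} {s e : A → Prop} {a b : A}
    (ha : s a) (hb : e b) (h : Relation.ReflTransGen r a b) :
    ∃ (N : ℕ) (v : ℕ → A), s (v 0) ∧ e (v N) ∧ (∀ j < N, r (v j) (v (j + 1))) ∧
      (∀ i j, i + 1 < j → j ≤ N → ¬ r (v i) (v j)) ∧
      (∀ j, 0 < j → j ≤ N → ¬ s (v j)) ∧ ∀ j < N, ¬ e (v j) := by
  classical
  let P : ℕ → Prop := fun N => ∃ v : ℕ → A, s (v 0) ∧ e (v N) ∧ ∀ j < N, r (v j) (v (j + 1))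
  have hP : ∃ N, P N := by
    obtain ⟨N, v, h0, hN, hv⟩ := exists_seq_of_reflTransGen h
    exact ⟨N, v, h0 ▸ ha, hN ▸ hb, hv⟩
  obtain ⟨v, h0, hN, hv⟩ := Nat.find_spec hP
  have hmin : ∀ M < Nat.find hP, ¬ P M := fun M hM => Nat.find_min hP hM
  generalize Nat.find hP = N at *
  refine ⟨N, v, h0, hN, hv, ?_, ?_, ?_⟩
  · intro i j hij hj hr
    -- Jump from `v i` directly to `v j`, omitting the `j - i - 1` vertices between them.
    refine hmin (N - (j - i - 1)) (by omega)
      ⟨fun t => if t ≤ i then v t else v (t + (j - i - 1)), by simpa using h0, ?_, ?_⟩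
    · beta_reduce
      rw [if_neg (by omega), Nat.sub_add_cancel (by omega)]
      exact hN
    · intro t ht
      beta_reduce
      rcases lt_trichotomy t i with h | rfl | h
      · rw [if_pos h.le, if_pos (by omega)]
        exact hv t (by omega)
      · rw [if_pos le_rfl, if_neg (by omega)]
        rwa [show t + 1 + (j - t - 1) = j by omega]
      · rw [if_neg (by omega), if_neg (by omega),
          show t + 1 + (j - i - 1) = t + (j - i - 1) + 1 by omega]
        exact hv _ (by omega)
  · intro j hj hjN hs
    refine hmin (N - j) (by omega) ⟨fun t => v (t + j), by simpa using hs, ?_, ?_⟩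
    · beta_reduce
      rw [Nat.sub_add_cancel hjN]
      exact hN
    · intro t ht
      beta_reduce
      rw [show t + 1 + j = t + j + 1 by omega]
      exact hv _ (by omega)
  · intro j hj he
    exact hmin j hj ⟨v, h0, he, fun t ht => hv t (by omega)⟩

theorem le_of_le_succ_upto {lab : ℕ → ℕ} {N : ℕ} (hmono : ∀ j < N, lab j ≤ lab (j + 1)) {i j : ℕ}
    (hij : i ≤ j) (hj : j ≤ N) : lab i ≤ lab j := by
  induction j, hij using Nat.le_induction with
  | base => exact le_rfl
  | succ j _ ih => exact (ih (by omega)).trans (hmono j (by omega))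

/-- A monotone labelling of `0, …, N` by consecutive numbers, from `0` to `l - 1`, cuts these
indices into `l` nonempty blocks of consecutive indices. -/
theorem exists_blocks_of_labels {l N : ℕ} (lab : ℕ → ℕ) (hl : 0 < l) (h0 : lab 0 = 0)
    (hN : lab N = l - 1) (hmono : ∀ j < N, lab j ≤ lab (j + 1))
    (hstep : ∀ j < N, lab (j + 1) ≤ lab j + 1) :
    ∃ t : ℕ → ℕ, t 0 = 0 ∧ t l = N + 1 ∧ (∀ i < l, t i < t (i + 1)) ∧
      ∀ i j, j ≤ N → t i ≤ j → j < t (i + 1) → lab j = i := by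
  classical
  -- The cut `t i` is the first index whose label is at least `i`; the alternative `j = N + 1`
  -- supplies the final cut `t l`.
  have hex : ∀ i, ∃ j, j = N + 1 ∨ i ≤ lab j := fun i => ⟨N + 1, Or.inl rfl⟩
  have hle : ∀ i, Nat.find (hex i) ≤ N + 1 := fun i => Nat.find_min' (hex i) (Or.inl rfl)
  have hlt : ∀ i j, j < Nat.find (hex i) → lab j < i := fun i j hj => by
    have := Nat.find_min (hex i) hj
    push Not at this
    exact this.2
  have hge : ∀ i j, j ≤ N → Nat.find (hex i) ≤ j → i ≤ lab j := fun i j hj hij => by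
    rcases Nat.find_spec (hex i) with h | h
    · omega
    · exact h.trans (le_of_le_succ_upto hmono hij hj)
  refine ⟨fun i => Nat.find (hex i), ?_, ?_, ?_, ?_⟩
  · exact Nat.le_zero.1 (Nat.find_min' (hex 0) (Or.inr (Nat.zero_le _)))
  · by_contra h
    have h1 : Nat.find (hex l) ≤ N := by have := hle l; simp only at h; omega
    have := hge l N le_rfl h1
    omega
  · intro i hi
    simp only
    have h1 : Nat.find (hex i) ≤ N := Nat.find_min' (hex i) (Or.inr (by omega))
    -- Labels rise by at most one, so `i` is not skipped and its block is nonempty.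
    have h2 : lab (Nat.find (hex i)) ≤ i := by
      rcases Nat.eq_zero_or_pos (Nat.find (hex i)) with h | h
      · rw [h, h0]; exact Nat.zero_le _
      · have h3 := hlt i (Nat.find (hex i) - 1) (by omega)
        have h4 := hstep (Nat.find (hex i) - 1) (by omega)
        rw [Nat.sub_add_cancel h] at h4
        omega
    by_contra h3
    have := hge (i + 1) _ h1 (not_lt.1 h3)
    omega
  · intro i j hj h1 h2
    have h3 := hge i j hj h1
    have h4 := hlt (i + 1) j h2
    omega

/-! ### Linking points of a connected set by small sets -/

/-- If every point `p` of a preconnected set `S` has a member of the family `F` as a neighbourhood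
within `S`, then any two points of `S` are linked by a chain of members of `F`. -/
theorem IsPreconnected.exists_reflTransGen {α ι : Type*} [TopologicalSpace α] {S : Set α}
    (hS : IsPreconnected S) (F : ι → Set α) (hF : ∀ p ∈ S, ∃ i, F i ∈ nhdsWithin p S)
    {a b : α} (ha : a ∈ S) (hb : b ∈ S) :
    ∃ i j, a ∈ F i ∧ b ∈ F j ∧
      Relation.ReflTransGen (fun i j => (F i ∩ F j ∩ S).Nonempty) i j := by
  refine hS.induction₂' (fun a b => ∃ i j, a ∈ F i ∧ b ∈ F j ∧
      Relation.ReflTransGen (fun i j => (F i ∩ F j ∩ S).Nonempty) i j) ?_ ?_ ha hb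
  · intro x hx
    obtain ⟨i, hi⟩ := hF x hx
    have hxi : x ∈ F i := mem_of_mem_nhdsWithin hx hi
    filter_upwards [hi] with y hy
    exact ⟨⟨i, i, hxi, hy, .refl⟩, ⟨i, i, hy, hxi, .refl⟩⟩
  · rintro x y z - hy - ⟨i, j, hi, hj, hij⟩ ⟨i', j', hi', hj', hij'⟩
    exact ⟨i, j', hi, hj', (hij.tail ⟨y, ⟨hj, hi'⟩, hy⟩).trans hij'⟩

/-- Every point lies in rational boxes of arbitrarily small diameter. -/
theorem exists_isRationalBox_mem {n : ℕ} (p : EuclideanSpace ℝ (Fin n)) {η : ℝ} (hη : 0 < η) :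
    ∃ R, IsRationalBox R ∧ p ∈ R ∧ diam R < η := by
  -- Coordinate errors of at most `c` give Euclidean distance at most `√n * c ≤ η / 3`, hence
  -- diameter at most `2 * η / 3`. Using `n + 1` covers `n = 0`.
  set c : ℝ := η / (3 * (n + 1)) with hc
  have hc0 : 0 < c := by positivity
  choose a ha using fun i => exists_rat_btwn (show p i - c < p i by linarith)
  choose b hb using fun i => exists_rat_btwn (show p i < p i + c by linarith)
  refine ⟨_, ⟨a, b, fun i => ?_, rfl⟩, fun i => ⟨(ha i).2, (hb i).1⟩, ?_⟩
  · exact_mod_cast (ha i).2.trans (hb i).1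
  · have hsub : {x : EuclideanSpace ℝ (Fin n) | ∀ i, (a i : ℝ) < x i ∧ x i < (b i : ℝ)} ⊆
        closedBall p (η / 3) := by
      intro x hx
      rw [mem_closedBall, EuclideanSpace.dist_eq]
      have hi : ∀ i, dist (x i) (p i) ^ 2 ≤ c ^ 2 := fun i => by
        refine pow_le_pow_left₀ dist_nonneg ?_ 2
        rw [Real.dist_eq, abs_le]
        have := hx i
        constructor <;> linarith [(ha i).1, (hb i).2]
      refine Real.sqrt_le_iff.2 ⟨by positivity, ?_⟩
      have hη' : η / 3 = (n + 1) * c := by rw [hc]; field_simp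
      calc ∑ i, dist (x i) (p i) ^ 2 ≤ ∑ _i : Fin n, c ^ 2 := Finset.sum_le_sum fun i _ => hi i
        _ = n * c ^ 2 := by simp
        _ ≤ (η / 3) ^ 2 := by
          rw [hη']
          nlinarith [mul_nonneg (sq_nonneg (n : ℝ)) (sq_nonneg c),
            mul_nonneg (Nat.cast_nonneg (α := ℝ) n) (sq_nonneg c), sq_nonneg c]
    have := (diam_mono hsub isBounded_closedBall).trans (diam_closedBall (by positivity))
    linarith

theorem IsRationalBox.isOpen {n : ℕ} {R : Set (EuclideanSpace ℝ (Fin n))} (hR : IsRationalBox R) :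
    IsOpen R := by
  obtain ⟨a, b, -, rfl⟩ := hR
  have : {x : EuclideanSpace ℝ (Fin n) | ∀ i, (a i : ℝ) < x i ∧ x i < (b i : ℝ)} =
      ⋂ i, {x : EuclideanSpace ℝ (Fin n) | (a i : ℝ) < x i ∧ x i < (b i : ℝ)} := by
    ext; simp
  rw [this]
  refine isOpen_iInter_of_finite fun i => ?_
  have hc : Continuous fun x : EuclideanSpace ℝ (Fin n) => x i := by fun_prop
  exact (isOpen_lt continuous_const hc).inter (isOpen_lt hc continuous_const)

theorem IsRationalBox.isBounded {n : ℕ} {R : Set (EuclideanSpace ℝ (Fin n))}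
    (hR : IsRationalBox R) : Bornology.IsBounded R := by
  obtain ⟨a, b, -, rfl⟩ := hR
  have h := (Metric.isBounded_Icc (fun i => (a i : ℝ)) (fun i => (b i : ℝ)))
  refine ((PiLp.antilipschitzWith_ofLp 2 (fun _ : Fin n => ℝ)).isBounded_preimage h).subset ?_
  exact fun x hx => ⟨fun i => (hx i).1.le, fun i => (hx i).2.le⟩

/-! ### The sets `C_ω` and `V_ω` of a witnessing chain -/

namespace WitnessingChain

variable {n : ℕ} {X : Set (EuclideanSpace ℝ (Fin n))} {f : ℕ → ℕ}

theorem R_subset_nbhd (w : WitnessingChain X f) (i : Fin w.k) : w.R i ⊆ w.nbhd i :=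
  self_subset_thickening (by positivity) _

theorem isOpen_nbhd (w : WitnessingChain X f) (i : Fin w.k) : IsOpen (w.nbhd i) :=
  isOpen_thickening

theorem isOpen_V (w : WitnessingChain X f) : IsOpen w.V :=
  isOpen_iUnion w.isOpen_nbhd

theorem nbhd_subset_V (w : WitnessingChain X f) (i : Fin w.k) : w.nbhd i ⊆ w.V :=
  subset_iUnion w.nbhd i

theorem R_inter_subset_Cset (w : WitnessingChain X f) (i : Fin w.k) :
    w.R i ∩ X ⊆ w.Cset i := fun z hz =>
  mem_iUnion₂.2 ⟨z, hz, mem_connectedComponentIn ⟨w.R_subset_nbhd i hz.1, hz.2⟩⟩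

theorem Cset_subset_C (w : WitnessingChain X f) (i : Fin w.k) : w.Cset i ⊆ w.C :=
  subset_iUnion w.Cset i

theorem R_inter_subset_C (w : WitnessingChain X f) (i : Fin w.k) : w.R i ∩ X ⊆ w.C :=
  (w.R_inter_subset_Cset i).trans (w.Cset_subset_C i)

theorem C_subset (w : WitnessingChain X f) : w.C ⊆ w.V ∩ X :=
  iUnion_subset fun i => iUnion₂_subset fun _ _ =>
    (connectedComponentIn_subset _ _).trans (inter_subset_inter_left _ (w.nbhd_subset_V i))

/-- The set `C_{ω,i}` is a single component. -/
theorem Cset_eq (w : WitnessingChain X f) (hf : IsLCFunction X f) (i : Fin w.k)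
    {z : EuclideanSpace ℝ (Fin n)} (hz : z ∈ w.R i ∩ X) :
    w.Cset i = connectedComponentIn (w.nbhd i ∩ X) z := by
  refine Subset.antisymm (iUnion₂_subset fun z' hz' => ?_) (subset_iUnion₂_of_subset z hz le_rfl)
  -- Points of one box are closer than `2 ^ (-f m)`, so `hf` joins them inside a ball of radius `2 ^
  -- (-m)`, which lies in the neighbourhood of the box.
  have h : z' ∈ connectedComponentIn (w.nbhd i ∩ X) z := by
    refine connectedComponentIn_mono z (inter_subset_inter_left X ?_)
      (hf w.m z hz.2 ⟨hz'.2, mem_ball.2 ?_⟩)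
    · exact ball_subset_thickening hz.1 _
    · exact (dist_le_diam_of_mem (w.isRationalBox i).isBounded hz'.1 hz.1).trans_lt (w.diam_lt i)
  rw [connectedComponentIn_eq h]

theorem isPreconnected_Cset (w : WitnessingChain X f) (hf : IsLCFunction X f) (i : Fin w.k) :
    IsPreconnected (w.Cset i) := by
  rcases (w.R i ∩ X).eq_empty_or_nonempty with h | ⟨z, hz⟩
  · simp [Cset, h, isPreconnected_empty]
  · rw [w.Cset_eq hf i hz]
    exact isPreconnected_connectedComponentIn

/-- Consecutive connected sets `C_{ω,i}` share the points of `X` common to their boxes. -/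
theorem isPreconnected_C (w : WitnessingChain X f) (hf : IsLCFunction X f) :
    IsPreconnected w.C := by
  have hmeet : ∀ i j : Fin w.k, (i : ℕ) + 1 = j → (w.Cset i ∩ w.Cset j).Nonempty := by
    intro i j hij
    obtain ⟨z, ⟨h1, h2⟩, hX⟩ := w.meets i j hij
    exact ⟨z, w.R_inter_subset_Cset i ⟨h1, hX⟩, w.R_inter_subset_Cset j ⟨h2, hX⟩⟩
  have hup : ∀ d, ∀ i j : Fin w.k, (i : ℕ) + d = j →
      Relation.ReflTransGen (fun i j => (w.Cset i ∩ w.Cset j).Nonempty) i j := by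
    intro d
    induction d with
    | zero =>
      intro i j hij
      obtain rfl : i = j := Fin.ext hij
      exact .refl
    | succ d ih =>
      intro i j hij
      have hlt : (i : ℕ) + d < w.k := by have := j.2; omega
      exact (ih i ⟨i + d, hlt⟩ rfl).tail (hmeet _ j (by simp only; omega))
  refine IsPreconnected.iUnion_of_reflTransGen (w.isPreconnected_Cset hf) fun i j => ?_
  rcases le_total i j with h | h
  · exact hup (j - i) i j (by have : (i : ℕ) ≤ j := h; omega)
  · have := hup (i - j) j i (by have : (j : ℕ) ≤ i := h; omega)
    rw [Relation.reflTransGen_swap] at this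
    exact this.lift id fun a b hab =>
      show (w.Cset a ∩ w.Cset b).Nonempty by rwa [inter_comm]

/-- The points of `C_ω` have arbitrarily small compact connected neighbourhoods in `X` that lie
in `C_ω`. -/
theorem exists_compact_nhd (w : WitnessingChain X f) (hX : IsClosed X) (hf : IsLCFunction X f)
    {p : EuclideanSpace ℝ (Fin n)} (hp : p ∈ w.C) {r : ℝ} (hr : 0 < r) :
    ∃ K, IsCompact K ∧ IsPreconnected K ∧ K ⊆ w.C ∧ K ⊆ closedBall p r ∧
      K ∈ nhdsWithin p X := by
  obtain ⟨i, hi⟩ := mem_iUnion.1 hp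
  obtain ⟨z, hz, hpz⟩ := mem_iUnion₂.1 hi
  have hpn := connectedComponentIn_subset _ _ hpz
  obtain ⟨s, hs, hsub⟩ := nhds_basis_closedBall.mem_iff.1 ((w.isOpen_nbhd i).mem_nhds hpn.1)
  obtain ⟨M, hM⟩ : ∃ M : ℕ, (2 : ℝ) ^ (-(M : ℤ)) < min r s := by
    obtain ⟨M, hM⟩ := exists_pow_lt_of_lt_one (lt_min hr hs) (show (2⁻¹ : ℝ) < 1 by norm_num)
    exact ⟨M, by simpa using hM⟩
  -- The closure of `D` is compact and still connected, and stays in `X` because `X` is closed; `hf`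
  -- at level `M` makes it a neighbourhood of `p` in `X`.
  set D := connectedComponentIn (ball p ((2 : ℝ) ^ (-(M : ℤ))) ∩ X) p with hD
  have hDball : closure D ⊆ closedBall p ((2 : ℝ) ^ (-(M : ℤ))) ∩ X :=
    closure_minimal ((connectedComponentIn_subset _ _).trans
      (inter_subset_inter_left _ ball_subset_closedBall)) (isClosed_closedBall.inter hX)
  have hpD : p ∈ D := mem_connectedComponentIn ⟨mem_ball_self (by positivity), hpn.2⟩
  have hconn : IsPreconnected (closure D) := isPreconnected_connectedComponentIn.closure
  refine ⟨closure D, ?_, hconn, ?_, ?_, ?_⟩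
  · exact (isCompact_closedBall _ _).of_isClosed_subset isClosed_closure
      (hDball.trans inter_subset_left)
  · refine Subset.trans ?_ (w.Cset_subset_C i)
    rw [w.Cset_eq hf i hz, connectedComponentIn_eq hpz]
    refine hconn.subset_connectedComponentIn (subset_closure hpD) (hDball.trans ?_)
    exact inter_subset_inter_left _
      ((closedBall_subset_closedBall (hM.le.trans (min_le_right _ _))).trans hsub)
  · exact hDball.trans (inter_subset_left.trans
      (closedBall_subset_closedBall (hM.le.trans (min_le_left _ _))))
  · have h1 := inter_mem_nhdsWithin X
      (ball_mem_nhds p (show (0 : ℝ) < 2 ^ (-(f M : ℤ)) by positivity))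
    exact Filter.mem_of_superset h1 ((hf M p hpn.2).trans subset_closure)

/-- Two points of a preconnected subset `K` of `X` are the ends of a witnessing chain that stays
close to `K`. -/
theorem exists_of_isPreconnected {K : Set (EuclideanSpace ℝ (Fin n))} (hK : IsPreconnected K)
    (hKX : K ⊆ X) (f : ℕ → ℕ) {δ : ℝ} (hδ : 0 < δ) {a b : EuclideanSpace ℝ (Fin n)}
    (ha : a ∈ K) (hb : b ∈ K) :
    ∃ w : WitnessingChain X f, a ∈ w.firstBox ∧ b ∈ w.lastBox ∧ w.V ⊆ thickening δ K := by
  obtain ⟨m, hm⟩ : ∃ m : ℕ, (2 : ℝ) ^ (-(m : ℤ)) < δ / 2 := by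
    obtain ⟨m, hm⟩ := exists_pow_lt_of_lt_one (half_pos hδ) (show (2⁻¹ : ℝ) < 1 by norm_num)
    exact ⟨m, by simpa using hm⟩
  -- A point of `V` is within `2 ^ (-m) < δ / 2` of a box, which meets `K` and has diameter below `δ
  -- / 2`.
  set η : ℝ := min (2 ^ (-(f m : ℤ))) (δ / 2) with hη
  have hη0 : 0 < η := lt_min (by positivity) (half_pos hδ)
  let ι := {R : Set (EuclideanSpace ℝ (Fin n)) //
    IsRationalBox R ∧ diam R < η ∧ (R ∩ K).Nonempty}
  obtain ⟨A, B, hA, hB, hAB⟩ := hK.exists_reflTransGen (fun R : ι => (R : Set _)) (fun p hp => by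
    obtain ⟨R, hR, hpR, hdR⟩ := exists_isRationalBox_mem p hη0
    exact ⟨⟨R, hR, hdR, p, hpR, hp⟩, mem_nhdsWithin_of_mem_nhds (hR.isOpen.mem_nhds hpR)⟩) ha hb
  obtain ⟨N, v, h0, hN, hv⟩ := exists_seq_of_reflTransGen hAB
  refine ⟨⟨m, N + 1, N.succ_pos, fun i => v i, fun i => (v i).2.1, ?_, ?_⟩, ?_, ?_, ?_⟩
  · intro i j hij
    have h := hv i (by have := j.2; omega)
    rw [hij] at h
    exact h.mono (inter_subset_inter_right _ hKX)
  · exact fun i => (v i).2.2.1.trans_le (min_le_left _ _)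
  · change a ∈ (v 0 : Set _)
    rwa [h0]
  · change b ∈ (v N : Set _)
    rwa [hN]
  · refine iUnion_subset fun i q hq => ?_
    obtain ⟨c, hc, hqc⟩ := mem_thickening_iff.1 hq
    obtain ⟨d, hd, hdK⟩ := (v i).2.2.2
    refine mem_thickening_iff.2 ⟨d, hdK, ?_⟩
    have h1 : dist c d < δ / 2 := (dist_le_diam_of_mem (v i).2.1.isBounded hc hd).trans_lt
      ((v i).2.2.1.trans_le (min_le_right _ _))
    have h2 : dist q c < (2 : ℝ) ^ (-(m : ℤ)) := hqc
    linarith [dist_triangle q c d]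

end WitnessingChain

/-! ### Thickenings of compact sets by small radii -/

/-- The `∀ᶠ` form lets finitely many demands on `δ` be met by a single radius. -/
theorem IsCompact.eventually_cthickening_subset {α : Type*} [PseudoMetricSpace α] {K U : Set α}
    (hK : IsCompact K) (hU : IsOpen U) (hKU : K ⊆ U) :
    ∀ᶠ δ in nhdsWithin (0 : ℝ) (Ioi 0), cthickening δ K ⊆ U := by
  obtain ⟨δ, hδ, h⟩ := hK.exists_cthickening_subset_open hU hKU
  filter_upwards [Ioc_mem_nhdsGT hδ] with η hη
  exact (cthickening_mono hη.2 K).trans h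

theorem IsCompact.eventually_disjoint_thickening {α : Type*} [PseudoMetricSpace α] {K L : Set α}
    (hK : IsCompact K) (hL : IsClosed L) (h : Disjoint K L) :
    ∀ᶠ δ in nhdsWithin (0 : ℝ) (Ioi 0), Disjoint (thickening δ K) (thickening δ L) := by
  obtain ⟨δ, hδ, h⟩ := h.exists_thickenings hK hL
  filter_upwards [Ioc_mem_nhdsGT hδ] with η hη
  exact h.mono (thickening_mono hη.2 K) (thickening_mono hη.2 L)

/-! ### Refining an arc chain -/

namespace ArcChain

variable {n : ℕ} {X : Set (EuclideanSpace ℝ (Fin n))} {f : ℕ → ℕ}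

/-- A compact connected subset of diameter at most `2 r` of the set `C_{𝔭,i}`, with its label `i`. -/
structure Piece (p : ArcChain X f) (r : ℝ) where
  label : Fin p.l
  carrier : Set (EuclideanSpace ℝ (Fin n))
  isCompact : IsCompact carrier
  isPreconnected : IsPreconnected carrier
  subset_C : carrier ⊆ p.C label
  small : ∃ c, carrier ⊆ closedBall c r

/-- Two pieces are linked if they meet and the label does not decrease. -/
def Piece.Linked {p : ArcChain X f} {r : ℝ} (a b : Piece p r) : Prop :=
  (a.carrier ∩ b.carrier).Nonempty ∧ a.label ≤ b.label

theorem C_subset (p : ArcChain X f) (i : Fin p.l) : p.C i ⊆ p.V i ∩ X :=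
  (p.w i).C_subset

/-- Two points of `C_{𝔭,i}` are connected by a path of linked pieces. -/
theorem exists_path_in_C (p : ArcChain X f) (hX : IsClosed X) (hf : IsLCFunction X f) {r : ℝ}
    (hr : 0 < r) (i : Fin p.l) {a b : EuclideanSpace ℝ (Fin n)} (ha : a ∈ p.C i) (hb : b ∈ p.C i) :
    ∃ A B : Piece p r, a ∈ A.carrier ∧ b ∈ B.carrier ∧ A.label = i ∧ B.label = i ∧
      Relation.ReflTransGen Piece.Linked A B := by
  obtain ⟨A, B, hA, hB, h⟩ := ((p.w i).isPreconnected_C hf).exists_reflTransGen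
    (fun A : {A : Piece p r // A.label = i} => A.1.carrier) (fun c hc => by
      obtain ⟨K, h1, h2, h3, h4, h5⟩ := (p.w i).exists_compact_nhd hX hf hc hr
      exact ⟨⟨⟨i, K, h1, h2, h3, c, h4⟩, rfl⟩,
        nhdsWithin_mono c ((p.C_subset i).trans inter_subset_right) h5⟩) ha hb
  exact ⟨A, B, hA, hB, A.2, B.2, h.lift Subtype.val fun A B hAB =>
    ⟨hAB.mono inter_subset_left, (A.2.trans B.2.symm).le⟩⟩

/-- The point `x` of the first set `C_{𝔭,1}` is connected to every point of every set `C_{𝔭,i}` by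
a path of linked pieces. -/
theorem exists_path (p : ArcChain X f) (hX : IsClosed X) (hf : IsLCFunction X f) {r : ℝ}
    (hr : 0 < r) {x : EuclideanSpace ℝ (Fin n)} (hx : x ∈ p.C p.first) (k : ℕ) (hk : k < p.l)
    {z : EuclideanSpace ℝ (Fin n)} (hz : z ∈ p.C ⟨k, hk⟩) :
    ∃ A B : Piece p r, x ∈ A.carrier ∧ z ∈ B.carrier ∧ B.label = ⟨k, hk⟩ ∧
      Relation.ReflTransGen Piece.Linked A B := by
  induction k generalizing z with
  | zero =>
    obtain ⟨A, B, hA, hB, -, hB', h⟩ := p.exists_path_in_C hX hf hr _ hx hz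
    exact ⟨A, B, hA, hB, hB', h⟩
  | succ k ih =>
    obtain ⟨u, ⟨huX, hu1⟩, hu2⟩ := p.meets ⟨k, by omega⟩ ⟨k + 1, hk⟩ rfl
    obtain ⟨A, B, hA, hB, hB', h⟩ := ih (by omega)
      ((p.w ⟨k, by omega⟩).R_inter_subset_C _ ⟨hu1, huX⟩)
    obtain ⟨A', B', hA1, hB1, hA2, hB2, h'⟩ := p.exists_path_in_C hX hf hr ⟨k + 1, hk⟩
      ((p.w _).R_inter_subset_C _ ⟨hu2, huX⟩) hz
    refine ⟨A, B', hA, hB1, hB2, (h.tail ⟨⟨u, hB, hA1⟩, ?_⟩).trans h'⟩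
    rw [hB', hA2, Fin.mk_le_mk]
    omega

/-- If `x` lies in the first member of a simple chain from `x` to `y` only, it determines the
index. -/
theorem IsFrom.eq_first {p : ArcChain X f} {x y : EuclideanSpace ℝ (Fin n)} (hp : p.IsFrom x y)
    {i : Fin p.l} (hi : x ∈ p.V i) : (i : ℕ) = 0 := by
  obtain ⟨-, hk, hx, -⟩ := hp
  by_contra h
  exact hx.2 (mem_iUnion₂.2 ⟨i, Nat.pos_of_ne_zero h, hi⟩)

theorem IsFrom.eq_last {p : ArcChain X f} {x y : EuclideanSpace ℝ (Fin n)} (hp : p.IsFrom x y)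
    {i : Fin p.l} (hi : y ∈ p.V i) : (i : ℕ) = p.l - 1 := by
  obtain ⟨-, hk, -, hy⟩ := hp
  by_contra h
  exact hy.2 (mem_iUnion₂.2 ⟨i, by have := i.2; omega, hi⟩)

/-- A minimal path of linked pieces from `x` to `y`: pieces that are not neighbours are disjoint,
and the ends lie in the outer pieces only. -/
theorem exists_simple_path (p : ArcChain X f) (hX : IsClosed X) (hf : IsLCFunction X f)
    {x y : EuclideanSpace ℝ (Fin n)} (hx : x ∈ p.C p.first) (hy : y ∈ p.C p.last) {r : ℝ}
    (hr : 0 < r) :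
    ∃ (N : ℕ) (K : ℕ → Piece p r), x ∈ (K 0).carrier ∧ y ∈ (K N).carrier ∧
      (∀ j < N, (K j).Linked (K (j + 1))) ∧
      (∀ i j, i + 1 < j → j ≤ N → Disjoint (K i).carrier (K j).carrier) ∧
      (∀ j, 0 < j → j ≤ N → x ∉ (K j).carrier) ∧ ∀ j < N, y ∉ (K j).carrier := by
  obtain ⟨A, B, hA, hB, -, hAB⟩ := p.exists_path hX hf hr hx _ _ hy
  obtain ⟨N, K, h0, hN, hK, hdis, hx', hy'⟩ := exists_minimal_seq
    (s := fun A : Piece p r => x ∈ A.carrier) (e := fun A : Piece p r => y ∈ A.carrier) hA hB hAB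
  refine ⟨N, K, h0, hN, hK, fun i j hij hj => ?_, hx', hy'⟩
  rw [disjoint_iff_inter_eq_empty, ← not_nonempty_iff_eq_empty]
  -- Labels are monotone along the path, so pieces that meet are already linked and would be a
  -- shortcut.
  exact fun h => hdis i j hij hj ⟨h, le_of_le_succ_upto (lab := fun j => ((K j).label : ℕ))
    (fun j hj => (hK j hj).2) (by omega) hj⟩

end ArcChain

theorem mainTheorem8 {n : ℕ} (X : Set (EuclideanSpace ℝ (Fin n)))
    (hXcompact : IsCompact X) (hXconn : IsConnected X)
    (f : ℕ → ℕ) (hf : IsLCFunction X f) (hfmono : StrictMono f)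
    (x y : EuclideanSpace ℝ (Fin n)) (p : ArcChain X f) (hp : p.IsFrom x y)
    (hx : x ∈ p.C p.first) (hy : y ∈ p.C p.last) :
    ∀ ε : ℝ, 0 < ε → ∃ q : ArcChain X f,
      (q.IsFrom x y ∧ x ∈ q.C q.first ∧ y ∈ q.C q.last) ∧
        q.diam < ε ∧ q.GoesThrough p := by
  intro ε hε
  -- Pieces in balls of radius `ε / 8`, thickened by `δ < ε / 8`, lie in balls of radius `ε / 4`, so
  -- the diameters are at most `ε / 2`.
  obtain ⟨N, K, hx0, hyN, hK, hdis, hx', hy'⟩ :=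
    p.exists_simple_path hXcompact.isClosed hf hx hy (show 0 < ε / 8 by positivity)
  have hKX : ∀ j, (K j).carrier ⊆ X := fun j =>
    (K j).subset_C.trans ((p.C_subset _).trans inter_subset_right)
  have hKV : ∀ j, (K j).carrier ⊆ p.V (K j).label := fun j =>
    (K j).subset_C.trans ((p.C_subset _).trans inter_subset_left)
  -- the blocks of the pieces with the same label
  obtain ⟨t, ht0, htl, htlt, ht⟩ := exists_blocks_of_labels (N := N)
    (fun j => ((K j).label : ℕ)) p.l_pos (hp.eq_first (hKV 0 hx0)) (hp.eq_last (hKV N hyN))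
    (fun j hj => (hK j hj).2) (fun j hj => by
      obtain ⟨z, hz1, hz2⟩ := (hK j hj).1
      have := (p.isSimpleChain _ _).1 ⟨z, hKV _ hz1, hKV _ hz2⟩
      rw [abs_le] at this
      omega)
  -- the points where consecutive witnessing chains meet
  obtain ⟨z, hz0, hzN, hz⟩ : ∃ z : ℕ → EuclideanSpace ℝ (Fin n), z 0 = x ∧ z (N + 1) = y ∧
      ∀ j ≤ N, z j ∈ (K j).carrier ∧ z (j + 1) ∈ (K j).carrier := by
    have hg : ∀ j, ∃ g, j < N → g ∈ (K j).carrier ∩ (K (j + 1)).carrier := fun j => by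
      by_cases h : j < N
      · obtain ⟨g, hg⟩ := (hK j h).1
        exact ⟨g, fun _ => hg⟩
      -- Dummy value: only indices below `N` matter.
      · exact ⟨x, fun h' => absurd h' h⟩
    choose g hg using hg
    refine ⟨fun j => if j = 0 then x else if j = N + 1 then y else g (j - 1), by simp, by simp,
      fun j hj => ⟨?_, ?_⟩⟩
    · rcases j with _ | j
      · simpa using hx0
      · simpa [show j ≠ N by omega] using (hg j (by omega)).2
    · rcases hj.eq_or_lt with rfl | hj
      · simpa using hyN
      · simpa [hj.ne] using (hg j hj).1
  -- the radius of the neighbourhoods of the pieces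
  obtain ⟨δ, ⟨⟨⟨⟨hδV, hδd⟩, hδx⟩, hδy⟩, hδε⟩, hδ⟩ : ∃ δ : ℝ, (((((∀ i : Fin (N + 1),
      cthickening δ (K i).carrier ⊆ p.V (K i).label) ∧
      (∀ i j : Fin (N + 1), (i : ℕ) + 1 < j →
        Disjoint (thickening δ (K i).carrier) (thickening δ (K j).carrier))) ∧
      (∀ i : Fin (N + 1), 0 < (i : ℕ) → cthickening δ (K i).carrier ⊆ {x}ᶜ)) ∧
      (∀ i : Fin (N + 1), (i : ℕ) < N → cthickening δ (K i).carrier ⊆ {y}ᶜ)) ∧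
      δ < ε / 8) ∧ 0 < δ := by
    refine Filter.Eventually.exists (f := nhdsWithin (0 : ℝ) (Ioi 0))
      (((((?_ : Filter.Eventually _ _).and ?_).and ?_).and ?_).and ?_ |>.and self_mem_nhdsWithin)
    · exact Filter.eventually_all.2 fun i =>
        (K i).isCompact.eventually_cthickening_subset (p.w _).isOpen_V (hKV i)
    · refine Filter.eventually_all.2 fun i => Filter.eventually_all.2 fun j =>
        Filter.eventually_imp_distrib_left.2 fun hij => ?_
      exact (K i).isCompact.eventually_disjoint_thickening (K j).isCompact.isClosed
        (hdis i j hij (by omega))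
    · refine Filter.eventually_all.2 fun i => Filter.eventually_imp_distrib_left.2 fun hi => ?_
      exact (K i).isCompact.eventually_cthickening_subset isOpen_compl_singleton
        (subset_compl_singleton_iff.2 (hx' i hi (by omega)))
    · refine Filter.eventually_all.2 fun i => Filter.eventually_imp_distrib_left.2 fun hi => ?_
      exact (K i).isCompact.eventually_cthickening_subset isOpen_compl_singleton
        (subset_compl_singleton_iff.2 (hy' i hi))
    · exact Filter.mem_of_superset (Ioo_mem_nhdsGT (show 0 < ε / 8 by positivity)) fun _ h => h.2
  -- the witnessing chains along the pieces
  choose w hwa hwb hwV using fun j : Fin (N + 1) =>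
    WitnessingChain.exists_of_isPreconnected (K j).isPreconnected (hKX j) f hδ
      (hz j (by omega)).1 (hz j (by omega)).2
  have hwc : ∀ j, (w j).V ⊆ cthickening δ (K j).carrier := fun j =>
    (hwV j).trans (thickening_subset_cthickening _ _)
  have hfirst : ∀ j, z j ∈ (w j).V := fun j =>
    (w j).nbhd_subset_V _ ((w j).R_subset_nbhd _ (hwa j))
  have hlast : ∀ j : Fin (N + 1), z (j + 1) ∈ (w j).V := fun j =>
    (w j).nbhd_subset_V _ ((w j).R_subset_nbhd _ (hwb j))
  have hsimple : IsSimpleChain fun j => (w j).V := by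
    have hfar : ∀ i j : Fin (N + 1), ((w i).V ∩ (w j).V).Nonempty → ¬ (i : ℕ) + 1 < j :=
      fun i j ⟨u, hu1, hu2⟩ hij => disjoint_left.1 (hδd i j hij) (hwV i hu1) (hwV j hu2)
    refine fun i j => ⟨fun h => ?_, fun h => ?_⟩
    · have h1 := hfar i j h
      have h2 := hfar j i (by rwa [inter_comm])
      rw [abs_le]
      omega
    · rw [abs_le] at h
      rcases lt_trichotomy (i : ℕ) j with h1 | h1 | h1
      · have h2 : (j : ℕ) = i + 1 := by omega
        exact ⟨z j, h2 ▸ hlast i, hfirst j⟩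
      · obtain rfl : i = j := Fin.ext h1
        exact ⟨z i, hfirst i, hfirst i⟩
      · have h2 : (i : ℕ) = j + 1 := by omega
        exact ⟨z i, hfirst i, h2 ▸ hlast j⟩
  have hxX : x ∈ X := hKX 0 hx0
  have hyX : y ∈ X := hKX N hyN
  have hx1 : x ∈ (w 0).firstBox := by simpa [hz0] using hwa 0
  have hy1 : y ∈ (w (Fin.last N)).lastBox := by simpa [hzN] using hwb (Fin.last N)
  let q : ArcChain X f := ⟨N + 1, N.succ_pos, w, hsimple, fun i j hij => by
    refine ⟨z j, ⟨hKX j (hz j (by omega)).1, ?_⟩, hwa j⟩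
    rw [← hij]
    exact hwb i⟩
  refine ⟨q, ⟨⟨hsimple, N.succ_pos, ⟨?_, ?_⟩, ?_, ?_⟩, ?_, ?_⟩, ?_, ?_⟩
  · change x ∈ (w 0).V
    simpa [hz0] using hfirst 0
  · simp only [mem_iUnion, not_exists]
    exact fun j hj h => hδx j hj (hwc j h) rfl
  · change y ∈ (w (Fin.last N)).V
    simpa [hzN] using hlast (Fin.last N)
  · simp only [mem_iUnion, not_exists]
    exact fun j hj h => hδy j hj (hwc j h) rfl
  · exact (w 0).R_inter_subset_C _ ⟨hx1, hxX⟩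
  · exact (w (Fin.last N)).R_inter_subset_C _ ⟨hy1, hyX⟩
  · have hdiam : ∀ j, Metric.diam (w j).V ≤ ε / 2 := fun j => by
      obtain ⟨c, hc⟩ := (K j).small
      have hsub : (w j).V ⊆ closedBall c (ε / 4) := fun u hu => by
        obtain ⟨v, hv, huv⟩ := mem_thickening_iff.1 (hwV j hu)
        have := mem_closedBall.1 (hc hv)
        rw [mem_closedBall]
        linarith [dist_triangle u v c]
      have := (diam_mono hsub isBounded_closedBall).trans (diam_closedBall (by positivity))
      linarith
    exact (ciSup_le (ι := Fin (N + 1)) hdiam).trans_lt (half_lt_self hε)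
  · refine ⟨fun i => t i, ht0, ?_, htl, fun i j h1 h2 => ?_⟩
    · exact Fin.strictMono_iff_lt_succ.2 fun i => htlt i i.2
    · have hlab : (K j).label = i := Fin.ext (ht i j (Nat.lt_succ_iff.1 j.2) h1 h2)
      rw [← hlab]
      -- Requiring the closed thickening to lie in `p.V` is what makes the passage narrow.
      exact (closure_minimal (hwc j) isClosed_cthickening).trans (hδV j)
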